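/- Let $K$ be a field, $X$ a finite set and $\Delta$ a simplicial complex on $X$, that is, a family of subsets of $X$ (faces) closed under taking subsets and containing $\emptyset$; let $d=\dim\Delta=\max\{|F|-1 : F\in\Delta\}$, and call $\Delta$ pure if all its facets (inclusion-maximal faces) have the same cardinality. The facet ideal of $\Delta$ is $I(\Delta)=(\prod_{x\in F}x : F \text{ a facet of } \Delta)\subseteq K[X]$. A monomial ideal has linear quotients if its minimal monomial generators can be ordered $f_1,\dots,f_m$ so that for every $2\le i\le m$ the colon ideal $(f_1,\dots,f_{i-1}):(f_i)$ is generated by a set of variables. Let $s\ge 1$ be an integer, $\alpha=(s,\dots,s)$, and let $X^\alpha=\{x_{t} : x\in X,\ 1\le t\le s\}$ consist of $s$ copies of each vertex. The expansion $\Delta^\alpha$ is the simplicial complex on $X^\alpha$ whose faces are all subsets of the sets $\{x_{j(x)} : x\in F\}$, where $F\in\Delta$ and $j:F\to\{1,\dots,s\}$. Let $\operatorname{pd}$ denote the projective dimension of an ideal as a module over its polynomial ring ($K[X]$ for $I(\Delta)$, $K[X^\alpha]$ for $I(\Delta^\alpha)$). If $I(\Delta)$ has linear quotients, then $\operatorname{pd}(I(\Delta))$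 and $\operatorname{pd}(I(\Delta^\alpha))$ are finite and $$\operatorname{pd}(I(\Delta^\alpha))\le s\cdot\operatorname{pd}(I(\Delta))+(d+1)(s-1).$$ If moreover $\Delta$ is pure, then $$\operatorname{pd}(I(\Delta^\alpha))= s\cdot\operatorname{pd}(I(\Delta))+(d+1)(s-1).$$ -/

import Mathlib

/-- A simplicial complex on the vertex set `V`: a set of finite subsets of `V` that is closed
under taking subsets and contains `∅`. As usual in combinatorial commutative algebra the empty
set counts as a face (so the complex `{∅}` of dimension `-1` is allowed), and a point of `V` need
not be a face. (Mathlib's `PreAbstractSimplicialComplex` excludes the empty face.) -/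
structure FaceComplex (V : Type*) where
  faces : Set (Finset V)
  empty_mem : ∅ ∈ faces
  down_closed : ∀ ⦃F G : Finset V⦄, F ∈ faces → G ⊆ F → G ∈ faces

namespace FaceComplex

/-- The facets, i.e. the faces that are maximal under inclusion. -/
def facets {V : Type*} (Δ : FaceComplex V) : Set (Finset V) :=
  {F | Maximal (· ∈ Δ.faces) F}

/-- `dim Δ = max {|F| - 1 : F ∈ Δ}`; used for finite `V` only, where the supremum is a maximum. -/
noncomputable def dim {V : Type*} (Δ : FaceComplex V) : ℤ :=
  ((sSup (Finset.card '' Δ.faces) : ℕ) : ℤ) - 1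

/-- `Δ` is pure if all its facets have the same dimension. -/
def IsPure {V : Type*} (Δ : FaceComplex V) : Prop :=
  ∀ F ∈ Δ.facets, ∀ G ∈ Δ.facets, F.card = G.card

/-- The set `{x_{i, j(i)} : i ∈ F}` in the expanded vertex set, whose points `⟨i, t⟩` are the
copies `x_{i,t}` of the vertex `i`, with `t` running through a set of `α i` elements. -/
def transversal {V : Type*} (α : V → ℕ) (F : Finset V) (j : (i : F) → Fin (α i)) :
    Finset (Σ i : V, Fin (α i)) :=
  (Finset.univ : Finset F).map
    ⟨fun i => ⟨i.1, j i⟩, fun _ _ h => Subtype.ext (congrArg Sigma.fst h)⟩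

/-- The expansion `Δ^α`, the union over all `F ∈ Δ` of the complexes `⟨F⟩^α` that are generated
by the sets `{x_{i, j(i)} : i ∈ F}`. -/
def expansion {V : Type*} (Δ : FaceComplex V) (α : V → ℕ) :
    FaceComplex (Σ i : V, Fin (α i)) where
  faces := {G | ∃ F ∈ Δ.faces, ∃ j : (i : F) → Fin (α i), G ⊆ transversal α F j}
  empty_mem := ⟨∅, Δ.empty_mem, fun i => absurd i.2 (Finset.notMem_empty _),
    Finset.empty_subset _⟩
  down_closed := fun _ _ ⟨F, hF, j, hj⟩ h => ⟨F, hF, j, h.trans hj⟩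

/-- The facet ideal `I(Δ) = (x^F : F a facet of Δ)` in `K[V]`, where `x^F = ∏_{i ∈ F} x_i`. -/
noncomputable def facetIdeal {V : Type*} (K : Type*) [Field K] (Δ : FaceComplex V) :
    Ideal (MvPolynomial V K) :=
  Ideal.span ((fun F : Finset V => ∏ i ∈ F, (MvPolynomial.X i : MvPolynomial V K)) '' Δ.facets)

end FaceComplex

namespace MonomialIdeal

/-- The exponent vectors of the minimal monomial generators of a monomial ideal `I`: the
monomials in `I` that are minimal under divisibility. -/
def minGens {V K : Type*} [Field K] (I : Ideal (MvPolynomial V K)) : Set (V →₀ ℕ) :=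
  {e | Minimal (fun e' => MvPolynomial.monomial e' (1 : K) ∈ I) e}

/-- A monomial ideal `I` has linear quotients if its minimal monomial generators can be ordered
as `f_1, …, f_m` such that each colon ideal `(f_1, …, f_{i-1}) : (f_i)` is generated by a set of
variables (for `i = 1` this holds trivially, with the empty set). -/
def HasLinearQuotients {V K : Type*} [Field K] (I : Ideal (MvPolynomial V K)) : Prop :=
  ∃ (m : ℕ) (f : Fin m → (V →₀ ℕ)), Function.Injective f ∧ Set.range f = minGens I ∧
    ∀ i : Fin m, ∃ A : Set V,
      (Ideal.span ((fun j => MvPolynomial.monomial (f j) (1 : K)) '' {j | j < i})).colon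
          (Ideal.span {MvPolynomial.monomial (f i) (1 : K)} : Ideal (MvPolynomial V K)) =
        Ideal.span ((MvPolynomial.X : V → MvPolynomial V K) '' A)

/-- The projective dimension of the ideal `I` as a module over the polynomial ring. -/
noncomputable def pd {V K : Type*} [Field K] (I : Ideal (MvPolynomial V K)) : WithBot ℕ∞ :=
  CategoryTheory.projectiveDimension (ModuleCat.of (MvPolynomial V K) I)

end MonomialIdeal

/-! For an ideal generated by an antichain of squarefree monomials `x^{F i}` with linear quotients,
the projective dimension is the largest size of a set `A i` of variables generating a colon ideal
(`pd_span_prod_X`). The theorem is then a count. Order the facets of the expansion by the underlying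
facet `F i` and, for equal `i`, by the sum of the chosen copy numbers. This gives linear quotients
again: the colon variables of `(i, j)` are all `s` copies of each vertex of `A i` and, for each `x ∈
F i`, the copies before `j x`. Their number is at most `s |A i| + (s - 1) |F i|`, with equality when
every `j x` is the last copy. Moreover `|F i| ≤ d + 1`, with equality if the complex is pure.

The upper bound in the formula comes from the exact sequence `0 → J : u → J × R → J + (u) → 0`. For
the lower bound, truncate after an index `i` with `|A i|` maximal and exhibit a nonzero Koszul
homology class in homological degree `|A i|` and multidegree `F i ∪ A i`
(`not_hasProjectiveDimensionLT_genIdeal`). Its construction needs the generators sorted by degree;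
sorting changes neither the linear quotients property nor the sets `A i`. -/

open CategoryTheory MvPolynomial

/-! ### Projective dimension when a generator is adjoined -/

namespace MonomialIdeal

section ProjectiveDimension

variable {R : Type*} [CommRing R]

/-- The map `J × R → J + (u)`, `(p, q) ↦ p + q u`. -/
def adjoinGenerator (J : Ideal R) (u : R) : (J × R) →ₗ[R] ↥(J ⊔ Ideal.span {u}) where
  toFun p := ⟨p.1 + p.2 * u, add_mem (Ideal.mem_sup_left p.1.2)
    (Ideal.mem_sup_right (Ideal.mul_mem_left _ _ (Ideal.mem_span_singleton_self u)))⟩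
  map_add' p q := by ext; simp; ring
  map_smul' a p := by ext; simp; ring

theorem adjoinGenerator_surjective (J : Ideal R) (u : R) :
    Function.Surjective (adjoinGenerator J u) := by
  rintro ⟨y, hy⟩
  obtain ⟨p, hp, q, hq, rfl⟩ := Submodule.mem_sup.1 hy
  obtain ⟨a, rfl⟩ := Ideal.mem_span_singleton'.1 hq
  exact ⟨(⟨p, hp⟩, a), rfl⟩

/-- The kernel of `J × R → J + (u)` is the colon ideal `J : u`. -/
def kerAdjoinGeneratorEquiv (J C : Ideal R) (u : R) (hC : ∀ q, q ∈ C ↔ q * u ∈ J) :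
    C ≃ₗ[R] LinearMap.ker (adjoinGenerator J u) where
  toFun q := ⟨(⟨-(q * u), neg_mem ((hC q).1 q.2)⟩, q), by
    simp [adjoinGenerator]⟩
  map_add' p q := by ext <;> simp; ring
  map_smul' a p := by ext <;> simp; ring
  invFun p := ⟨p.1.2, by
    have h : (p.1.1 : R) + p.1.2 * u = 0 := congrArg Subtype.val p.2
    rw [hC, eq_neg_of_add_eq_zero_right h]
    exact neg_mem p.1.1.2⟩
  left_inv q := rfl
  right_inv p := by
    have h : (p.1.1 : R) + p.1.2 * u = 0 := congrArg Subtype.val p.2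
    ext
    · simp [eq_neg_of_add_eq_zero_left h]
    · rfl

theorem hasProjectiveDimensionLT_sup_span (J C : Ideal R) (u : R)
    (hC : ∀ q, q ∈ C ↔ q * u ∈ J) (n : ℕ)
    (h₁ : HasProjectiveDimensionLT (ModuleCat.of R C) n)
    (h₂ : HasProjectiveDimensionLT (ModuleCat.of R J) (n + 1)) :
    HasProjectiveDimensionLT (ModuleCat.of R ↥(J ⊔ Ideal.span {u})) (n + 1) := by
  have hS := LinearMap.shortExact_shortComplexKer (adjoinGenerator_surjective J u)
  refine hS.hasProjectiveDimensionLT_X₃ n ?_ ?_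
  · exact hasProjectiveDimensionLT_of_iso (kerAdjoinGeneratorEquiv J C u hC).toModuleIso n
  · have : Projective (ModuleCat.of R R) := inferInstance
    exact hasProjectiveDimensionLT_of_iso (ModuleCat.biprodIsoProd (.of R J) (.of R R)) _

/-- In the sequence `0 → C → J × R → J + (u) → 0` the middle term inherits the bound of the outer
two, and `J` is a retract of it. This descends a bound to fewer generators. -/
theorem hasProjectiveDimensionLT_of_sup_span (J C : Ideal R) (u : R)
    (hC : ∀ q, q ∈ C ↔ q * u ∈ J) (n : ℕ)
    (h₁ : HasProjectiveDimensionLT (ModuleCat.of R C) n)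
    (h₃ : HasProjectiveDimensionLT (ModuleCat.of R ↥(J ⊔ Ideal.span {u})) n) :
    HasProjectiveDimensionLT (ModuleCat.of R J) n := by
  have hS := LinearMap.shortExact_shortComplexKer (adjoinGenerator_surjective J u)
  have h₁' := hasProjectiveDimensionLT_of_iso (kerAdjoinGeneratorEquiv J C u hC).toModuleIso n
  have h₂ : HasProjectiveDimensionLT (ModuleCat.of R (J × R)) n :=
    hS.hasProjectiveDimensionLT_X₂ n h₁' h₃
  let r : Retract (ModuleCat.of R J) (ModuleCat.of R (J × R)) :=
    { i := ModuleCat.ofHom (LinearMap.inl R J R)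
      r := ModuleCat.ofHom (LinearMap.fst R J R) }
  exact r.hasProjectiveDimensionLT n

/-- Adjoin the variables one at a time: for `a ∉ A` the colon of `(X_b : b ∈ A)` by `X_a` is that
ideal itself. -/
theorem hasProjectiveDimensionLT_span_X {V K : Type*} [Field K] (A : Finset V) :
    HasProjectiveDimensionLT (ModuleCat.of (MvPolynomial V K)
      (Ideal.span ((X : V → MvPolynomial V K) '' A))) A.card := by
  classical
  induction A using Finset.induction_on with
  | empty =>
    have h : Ideal.span ((X : V → MvPolynomial V K) '' (∅ : Finset V)) = ⊥ := by simp
    have : Subsingleton (Ideal.span ((X : V → MvPolynomial V K) '' (∅ : Finset V))) := by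
      rw [h]; infer_instance
    exact (ModuleCat.isZero_of_subsingleton _).hasProjectiveDimensionLT_zero
  | insert a A ha ih =>
    rw [Finset.coe_insert, Set.image_insert_eq, Ideal.span_insert, sup_comm,
      Finset.card_insert_of_notMem ha]
    refine hasProjectiveDimensionLT_sup_span _ _ _ (fun q => ?_) _ ih
      (hasProjectiveDimensionLT_of_ge _ _ _ (Nat.le_succ _))
    refine ⟨fun h => Ideal.mul_mem_right _ _ h, fun h => ?_⟩
    rw [mem_ideal_span_X_image] at h ⊢
    intro m hm
    obtain ⟨i, hi, h0⟩ := h (m + Finsupp.single a 1) (by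
      rw [mem_support_iff] at hm ⊢
      rwa [coeff_mul_X])
    refine ⟨i, hi, ?_⟩
    have : i ≠ a := by rintro rfl; exact ha hi
    simpa [this.symm] using h0

end ProjectiveDimension

end MonomialIdeal

/-! ### The Koszul complex and its contracting homotopies -/

namespace Koszul

variable {V : Type*} [LinearOrder V]

/-- The sign of moving `v` to its place in the increasing enumeration of `insert v S`. -/
def sgn (v : V) (S : Finset V) : ℤ := (-1) ^ (S.filter (· < v)).card

theorem sgn_mul_self (v : V) (S : Finset V) : sgn v S * sgn v S = 1 := by
  rw [sgn, ← pow_add, ← two_mul, pow_mul]; simp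

theorem sgn_insert {v w : V} {S : Finset V} (hv : v ∉ S) :
    sgn w (insert v S) = if v < w then -sgn w S else sgn w S := by
  unfold sgn
  rw [Finset.filter_insert]
  split_ifs with h
  · rw [Finset.card_insert_of_notMem (by simp [hv]), pow_succ]; ring
  · rfl

theorem sgn_mul_sgn_insert {v w : V} (h : v ≠ w) {S : Finset V} (hv : v ∉ S) (hw : w ∉ S) :
    sgn v S * sgn w (insert v S) = -(sgn w S * sgn v (insert w S)) := by
  rw [sgn_insert hv, sgn_insert hw]
  rcases lt_or_gt_of_ne h with h | h <;> simp [h, h.not_gt] <;> ring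

variable {M N : Type*} [AddCommGroup M] [AddCommGroup N]

/-- Contraction of an element `∑ f S e_S` of the exterior algebra by the dual of `e_v`. -/
def contract (v : V) : (Finset V → M) →+ (Finset V → M) where
  toFun f S := if v ∈ S then 0 else sgn v S • f (insert v S)
  map_zero' := by ext; simp
  map_add' f g := by ext S; by_cases h : v ∈ S <;> simp [h]

/-- Left multiplication by `e_v` in the exterior algebra. -/
def wedge (v : V) : (Finset V → M) →+ (Finset V → M) where
  toFun f S := if v ∈ S then sgn v (S.erase v) • f (S.erase v) else 0
  map_zero' := by ext; simp
  map_add' f g := by ext S; by_cases h : v ∈ S <;> simp [h]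

theorem contract_apply (v : V) (f : Finset V → M) (S : Finset V) :
    contract v f S = if v ∈ S then 0 else sgn v S • f (insert v S) := rfl

theorem wedge_apply (v : V) (f : Finset V → M) (S : Finset V) :
    wedge v f S = if v ∈ S then sgn v (S.erase v) • f (S.erase v) else 0 := rfl

theorem contract_comp (φ : M →+ N) (v : V) (f : Finset V → M) :
    contract v (φ ∘ f) = φ ∘ contract v f := by
  ext S; by_cases h : v ∈ S <;> simp [contract_apply, h]

theorem contract_contract_self (v : V) (f : Finset V → M) : contract v (contract v f) = 0 := by
  ext S; simp [contract_apply]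

theorem contract_contract {v w : V} (h : v ≠ w) (f : Finset V → M) :
    contract v (contract w f) = -contract w (contract v f) := by
  ext S
  by_cases hv : v ∈ S <;> by_cases hw : w ∈ S <;>
    simp [contract_apply, hv, hw, h, h.symm, smul_smul]
  rw [sgn_mul_sgn_insert h hv hw, neg_smul, Finset.insert_comm]

theorem contract_wedge_of_ne {v w : V} (h : w ≠ v) (f : Finset V → M) :
    contract w (wedge v f) = -wedge v (contract w f) := by
  ext S
  by_cases hv : v ∈ S <;> by_cases hw : w ∈ S <;>
    simp [contract_apply, wedge_apply, hv, hw, h, h.symm, smul_smul]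
  obtain ⟨T, hT, rfl⟩ : ∃ T, v ∉ T ∧ insert v T = S :=
    ⟨S.erase v, Finset.notMem_erase v S, Finset.insert_erase hv⟩
  have hwT : w ∉ T := fun h' => hw (Finset.mem_insert_of_mem h')
  rw [Finset.insert_comm, Finset.erase_insert (by simp [hT, h.symm]), Finset.erase_insert hT,
    ← neg_smul]
  congr 1
  rw [sgn_insert hT, sgn_insert hwT]
  rcases lt_or_gt_of_ne h with h | h <;> simp [h, h.not_gt] <;> ring

theorem contract_wedge_self_apply (v : V) (f : Finset V → M) (S : Finset V) :
    contract v (wedge v f) S = if v ∈ S then 0 else f S := by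
  by_cases hv : v ∈ S <;> simp [contract_apply, wedge_apply, hv, smul_smul, sgn_mul_self]

theorem wedge_contract_self_apply (v : V) (f : Finset V → M) (S : Finset V) :
    wedge v (contract v f) S = if v ∈ S then f S else 0 := by
  by_cases hv : v ∈ S <;>
    simp [contract_apply, wedge_apply, hv, smul_smul, sgn_mul_self, Finset.insert_erase]

variable {R : Type*} [CommRing R] [Module R M] [Module R N]

theorem contract_smul (v : V) (a : R) (f : Finset V → M) :
    contract v (a • f) = a • contract v f := by
  ext S
  by_cases h : v ∈ S
  · simp [contract_apply, h]
  · simp only [contract_apply, h, if_false, Pi.smul_apply]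
    rw [smul_comm]

variable [Fintype V]

/-- The differential of the Koszul complex of the family `x` with coefficients in `M`; its
underlying module is that of all families `f = ∑ f S e_S` indexed by the subsets `S` of `V`. -/
def differential (x : V → R) : (Finset V → M) →+ (Finset V → M) where
  toFun f S := ∑ v, x v • contract v f S
  map_zero' := by ext; simp
  map_add' f g := by ext S; simp [Finset.sum_add_distrib]

theorem differential_apply (x : V → R) (f : Finset V → M) (S : Finset V) :
    differential x f S = ∑ v, x v • contract v f S := rfl

theorem differential_comp (x : V → R) (φ : M →ₗ[R] N) (f : Finset V → M) :
    differential x (φ ∘ f) = φ ∘ differential x f := by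
  ext S
  have h := contract_comp (φ : M →+ N) (f := f)
  simp only [AddMonoidHom.coe_coe] at h
  simp [differential_apply, h]

theorem differential_eq_sum (x : V → R) (f : Finset V → M) :
    differential x f = ∑ v, x v • contract v f := by
  ext S; simp [differential_apply]

theorem differential_differential (x : V → R) (f : Finset V → M) :
    differential x (differential x f) = 0 := by
  simp only [differential_eq_sum, map_sum, contract_smul, smul_smul]
  rw [← Finset.sum_product']
  -- The terms of `(v, w)` and `(w, v)` cancel because contractions anticommute.
  refine Finset.sum_involution (fun p _ => p.swap) ?_ ?_ (by simp) (by simp)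
  · rintro ⟨v, w⟩ -
    by_cases h : v = w
    · subst h; simp [contract_contract_self]
    · simp [contract_contract h, mul_comm (x w)]
  · rintro ⟨v, w⟩ - h0 h
    obtain rfl : w = v := congrArg Prod.fst h
    simp [contract_contract_self] at h0

/-- The homotopy formula for `e_v ∧ -` followed by `T v`: for `w ≠ v`, contraction by `w`
anticommutes with the wedge, so only the terms of index `v` survive. -/
theorem differential_wedge (x : V → R) (T : V → M →+ M) (v : V)
    (h₁ : ∀ m, T v (x v • m) = m) (h₂ : ∀ w, w ≠ v → ∀ m, T v (x w • m) = x w • T v m)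
    (z : Finset V → M) (S : Finset V) :
    differential x (T v ∘ wedge v z) S + T v (wedge v (differential x z) S) =
      if v ∈ S then z S else x v • T v (z S) := by
  have h : wedge v (differential x z) S = ∑ w, x w • wedge v (contract w z) S := by
    by_cases hv : v ∈ S
    · simp only [wedge_apply, hv, if_true, differential_apply, Finset.smul_sum]
      exact Finset.sum_congr rfl fun w _ => smul_comm _ _ _
    · simp [wedge_apply, hv]
  rw [h, differential_apply, map_sum, ← Finset.sum_add_distrib,
    Finset.sum_eq_single v]
  · rw [h₁, contract_comp, Function.comp_apply, contract_wedge_self_apply,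
      wedge_contract_self_apply]
    split_ifs <;> simp
  · intro w _ hw
    rw [h₂ w hw, contract_comp, contract_wedge_of_ne hw]
    simp
  · simp

/-- If division by each `x v` is possible in a way that commutes with the other `x w`, then the
Koszul complex is acyclic in positive degrees. -/
theorem exists_differential_eq_of_division (x : V → R) (T : V → M →+ M)
    (h₁ : ∀ v m, T v (x v • m) = m)
    (h₂ : ∀ v w, w ≠ v → ∀ m, T v (x w • m) = x w • T v m)
    (z : Finset V → M) (hz : differential x z = 0) (h0 : z ∅ = 0) :
    ∃ y : Finset V → M, differential x y = z := by
  -- Clear the vertices one by one. Correcting by the homotopy of `v` kills the coefficients at all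
  -- `S ∋ v`, and elsewhere it preserves the zeros already obtained.
  have key : ∀ B : Finset V, ∃ y : Finset V → M, ∀ S : Finset V,
      (S = ∅ ∨ ∃ b ∈ B, b ∈ S) → (z - differential x y) S = 0 := by
    intro B
    induction B using Finset.induction_on with
    | empty => exact ⟨0, by simpa using h0⟩
    | insert v B hv ih =>
      obtain ⟨y, hy⟩ := ih
      set z' := z - differential x y with hz'
      have hd : differential x z' = 0 := by
        rw [hz', map_sub, hz, differential_differential, sub_zero]
      refine ⟨y + (T v ∘ wedge v z'), fun S hS => ?_⟩
      have h := differential_wedge x T v (h₁ v) (h₂ v) z' S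
      rw [hd, map_zero, Pi.zero_apply, map_zero, add_zero] at h
      rw [map_add, ← sub_sub, ← hz', Pi.sub_apply, h]
      split_ifs with hvS
      · exact sub_self _
      · have : z' S = 0 := by
          refine hy S (hS.imp id ?_)
          rintro ⟨b, hb, hbS⟩
          rcases Finset.mem_insert.1 hb with rfl | hb
          · exact absurd hbS hvS
          · exact ⟨b, hb, hbS⟩
        simp [this]
  obtain ⟨y, hy⟩ := key Finset.univ
  refine ⟨y, (sub_eq_zero.1 (funext fun S => hy S ?_)).symm⟩
  rcases S.eq_empty_or_nonempty with h | ⟨b, hb⟩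
  · exact .inl h
  · exact .inr ⟨b, Finset.mem_univ b, hb⟩

end Koszul

/-! ### Koszul homology bounds projective dimension from below -/

namespace Koszul

universe u v

variable {V : Type u} [LinearOrder V] {K : Type v} [Field K]

theorem X_mul_divMonomial_of_ne {v w : V} (h : w ≠ v) (p : MvPolynomial V K) :
    (X w * p).divMonomial (Finsupp.single v 1) = X w * p.divMonomial (Finsupp.single v 1) := by
  ext m
  rw [coeff_divMonomial, coeff_X_mul', coeff_X_mul', coeff_divMonomial]
  have h1 : w ∈ (Finsupp.single v 1 + m).support ↔ w ∈ m.support := by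
    simp [h.symm]
  simp only [h1]
  split_ifs with h2
  · congr 1
    refine add_tsub_assoc_of_le ?_ _
    rw [Finsupp.single_le_iff]
    exact Nat.one_le_iff_ne_zero.2 (Finsupp.mem_support_iff.1 h2)
  · rfl

variable [Fintype V]

theorem exists_differential_eq_of_finsupp {ι : Type*}
    (z : Finset V → (ι →₀ MvPolynomial V K)) (hz : differential (X (R := K)) z = 0) (h0 : z ∅ = 0) :
    ∃ y, differential (X (R := K)) y = z := by
  -- Discarding the monomials not divisible by `X v` and dividing the others is additive, inverts
  -- multiplication by `X v`, and commutes with the other variables.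
  let D : V → MvPolynomial V K →+ MvPolynomial V K := fun v =>
    { toFun := fun p => p.divMonomial (Finsupp.single v 1)
      map_zero' := zero_divMonomial _
      map_add' := fun p q => add_divMonomial p q _ }
  refine exists_differential_eq_of_division (X (R := K)) (fun v => Finsupp.mapRange.addMonoidHom (D v))
    (fun v m => ?_) (fun v w h m => ?_) z hz h0
  · ext1 i
    exact X_mul_divMonomial v (m i)
  · ext1 i
    exact X_mul_divMonomial_of_ne h (m i)

theorem differential_update_empty {M R : Type*} [CommRing R] [AddCommGroup M] [Module R M]
    (x : V → R) (f : Finset V → M) (m : M) :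
    differential x (Function.update f ∅ m) = differential x f := by
  ext S
  refine Finset.sum_congr rfl fun v _ => ?_
  simp [contract_apply]

theorem differential_eq_zero_of_card_lt {M R : Type*} [CommRing R] [AddCommGroup M] [Module R M]
    (x : V → R) {f : Finset V → M} {n : ℕ} (hf : ∀ S : Finset V, S.card < n + 1 → f S = 0)
    (S : Finset V) (hS : S.card < n) : differential x f S = 0 := by
  refine Finset.sum_eq_zero fun v _ => ?_
  rw [contract_apply]
  split_ifs with h
  · simp
  · rw [hf _ (by rw [Finset.card_insert_of_notMem h]; omega)]; simp

/-- The Koszul homology of a module of projective dimension at most `n` vanishes in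
degrees above `n`. -/
theorem exists_differential_eq_of_hasProjectiveDimensionLT (n : ℕ) :
    ∀ (M : Type (max u v)) [AddCommGroup M] [Module (MvPolynomial V K) M]
      [HasProjectiveDimensionLT (ModuleCat.of (MvPolynomial V K) M) (n + 1)]
      (z : Finset V → M), differential (X (R := K)) z = 0 → (∀ S : Finset V, S.card < n + 1 → z S = 0) →
      ∃ y, differential (X (R := K)) y = z := by
  induction n with
  | zero =>
    intro M _ _ hM z hz h0
    have : Module.Projective (MvPolynomial V K) M := by
      rw [IsProjective.iff_projective, projective_iff_hasProjectiveDimensionLT_one]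
      exact hM
    obtain ⟨s, hs⟩ := Module.projective_lifting_property
      (Finsupp.linearCombination (MvPolynomial V K) (id : M → M)) LinearMap.id
      (Finsupp.linearCombination_id_surjective _ M)
    obtain ⟨y, hy⟩ := exists_differential_eq_of_finsupp (s ∘ z)
      (by rw [differential_comp, hz]; ext1; simp) (by simp [h0 ∅ (by simp)])
    refine ⟨Finsupp.linearCombination (MvPolynomial V K) (id : M → M) ∘ y, ?_⟩
    rw [differential_comp, hy]
    ext S
    exact LinearMap.congr_fun hs (z S)
  | succ n ih =>
    intro M _ _ hM z hz h0
    let p := Finsupp.linearCombination (MvPolynomial V K) (id : M → M)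
    have hp : Function.Surjective p := Finsupp.linearCombination_id_surjective _ M
    have hS := LinearMap.shortExact_shortComplexKer hp
    have hker : HasProjectiveDimensionLT
        (ModuleCat.of (MvPolynomial V K) (LinearMap.ker p)) (n + 1) := by
      refine hS.hasProjectiveDimensionLT_X₁ (n + 1) ?_ hM
      have : Projective (ModuleCat.of (MvPolynomial V K) (M →₀ MvPolynomial V K)) := by
        rw [← IsProjective.iff_projective]; infer_instance
      exact hasProjectiveDimensionLT_of_ge _ 1 _ (by omega)
    obtain ⟨z', hz', hz'0⟩ : ∃ z' : Finset V → (M →₀ MvPolynomial V K), p ∘ z' = z ∧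
        ∀ S : Finset V, S.card < n + 1 + 1 → z' S = 0 := by
      choose g hg using hp
      refine ⟨fun S => if S.card < n + 1 + 1 then 0 else g (z S), ?_, fun S hS => if_pos hS⟩
      ext S
      by_cases h : S.card < n + 1 + 1
      · simp only [Function.comp_apply, if_pos h, map_zero, h0 S h]
      · simp only [Function.comp_apply, if_neg h, hg]
    -- Connecting map of `0 → ker p → free → M → 0`: the differential of the lift is a cycle in `ker
    -- p`, one degree lower, to which induction applies.
    have hmem : ∀ S, differential (X (R := K)) z' S ∈ LinearMap.ker p := fun S => by
      have h := congrFun (differential_comp (X (R := K)) p z') S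
      rw [hz', hz] at h
      exact h.symm
    let c : Finset V → LinearMap.ker p := fun S => ⟨differential (X (R := K)) z' S, hmem S⟩
    have hc : (LinearMap.ker p).subtype ∘ c = differential (X (R := K)) z' := rfl
    obtain ⟨w, hw⟩ := ih (LinearMap.ker p) c
      (by
        have h := differential_comp (X (R := K)) (LinearMap.ker p).subtype c
        rw [hc, differential_differential] at h
        ext1 S
        exact Subtype.ext (congrFun h S).symm)
      (fun S hS => Subtype.ext (differential_eq_zero_of_card_lt (X (R := K)) hz'0 S hS))
    -- The differential never reads the coefficient at `∅`; it is reset so that `z' - w'` vanishes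
    -- there, as acyclicity of the free module requires.
    let w' := Function.update w ∅ 0
    have hw' : differential (X (R := K)) w' = c := by rw [differential_update_empty, hw]
    obtain ⟨y, hy⟩ := exists_differential_eq_of_finsupp (z' - (LinearMap.ker p).subtype ∘ w')
      (by
        have h := differential_comp (X (R := K)) (LinearMap.ker p).subtype w'
        rw [hw', hc] at h
        rw [map_sub]
        exact sub_eq_zero.2 h.symm)
      (by simp [hz'0 ∅ (by simp), w'])
    refine ⟨p ∘ y, ?_⟩
    rw [differential_comp, hy]
    ext S
    have h2 : p (w' S) = 0 := (w' S).2
    simp only [Function.comp_apply, Pi.sub_apply, map_sub, Submodule.subtype_apply, h2, sub_zero]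
    exact congrFun hz' S

end Koszul

/-- A family `F` of finite sets has linear quotients with colon sets `A` if, for each `i`, the
elements of `A i` are those `a ∉ F i` for which some earlier `F k` is contained in
`insert a (F i)`, and every earlier `F j` meets `A i` outside `F i`. -/
structure HasColonSets {V ι : Type*} [DecidableEq V] [LT ι] (F A : ι → Finset V) : Prop where
  inter_nonempty : ∀ ⦃i j⦄, j < i → ∃ a ∈ A i, a ∈ F j ∧ a ∉ F i
  notMem : ∀ ⦃i a⦄, a ∈ A i → a ∉ F i
  exists_subset_insert : ∀ ⦃i a⦄, a ∈ A i → ∃ k < i, F k ⊆ insert a (F i)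

/-! ### Simplicial homology of upper Koszul complexes -/

namespace HasColonSets

variable {V : Type*} [LinearOrder V] {m : ℕ} {F A : Fin m → Finset V}

open Koszul

/-- The faces of the upper Koszul complex, in the squarefree degree `σ`, of the ideal generated by
the members of `F` of index less than `n`. -/
def IsFace (F : Fin m → Finset V) (σ : Finset V) (n : ℕ) (S : Finset V) : Prop :=
  S ⊆ σ ∧ ∃ l : Fin m, l.val < n ∧ F l ⊆ σ \ S

theorem IsFace.subset {σ S T : Finset V} {n : ℕ} (h : IsFace F σ n S) (hT : T ⊆ S) :
    IsFace F σ n T := by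
  obtain ⟨h1, l, hl, h2⟩ := h
  exact ⟨hT.trans h1, l, hl, h2.trans (Finset.sdiff_subset_sdiff subset_rfl hT)⟩

variable {K : Type*} [Field K]

theorem contract_eq_zero_of_subset_closed {P : Finset V → Prop}
    (hP : ∀ S T, P S → T ⊆ S → P T) {f : Finset V → K} (hf : ∀ S, ¬ P S → f S = 0) (v : V)
    (S : Finset V) (hS : ¬ P S) : contract v f S = 0 := by
  rw [contract_apply]
  split_ifs
  · rfl
  · rw [hf _ fun h => hS (hP _ _ h (Finset.subset_insert v S)), smul_zero]

variable [Fintype V]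

/-- With all coefficients `1` the Koszul differential is the augmented simplicial boundary.
Adjoining a generator adds an interval of faces, which either is matched by toggling a vertex, and
so adds no homology, or has only the candidate `σ \ F l`, too large to matter for chains on
`k`-element faces. -/
theorem exists_boundary (h : HasColonSets F A) (σ : Finset V) (k n : ℕ) (hn : n ≤ m)
    (hk : ∀ l : Fin m, l.val < n → F l ⊆ σ → k < (σ \ F l).card)
    (f : Finset V → K) (hf : ∀ S, ¬ (IsFace F σ n S ∧ S.card = k) → f S = 0)
    (hd : differential (fun _ => (1 : K)) f = 0) :
    ∃ g : Finset V → K, (∀ S, ¬ (IsFace F σ n S ∧ S.card = k + 1) → g S = 0) ∧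
      differential (fun _ => (1 : K)) g = f := by
  induction n generalizing f with
  | zero =>
    refine ⟨0, fun _ _ => rfl, ?_⟩
    rw [map_zero]
    ext S
    refine (hf S ?_).symm
    rintro ⟨⟨-, l, hl, -⟩, -⟩
    omega
  | succ n ih =>
    have mono : ∀ S, IsFace F σ n S → IsFace F σ (n + 1) S :=
      fun S ⟨h1, l, hl, h2⟩ => ⟨h1, l, by omega, h2⟩
    let i : Fin m := ⟨n, hn⟩
    -- it suffices to remove the faces which are not faces of the smaller complex
    suffices H : ∃ g : Finset V → K, (∀ S, ¬ (IsFace F σ (n + 1) S ∧ S.card = k + 1) → g S = 0) ∧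
        ∀ S, ¬ IsFace F σ n S → differential (fun _ => (1 : K)) g S = f S by
      obtain ⟨g, hg, hgf⟩ := H
      obtain ⟨g', hg', hgf'⟩ := ih (by omega) (fun l hl => hk l (by omega))
        (f - differential (fun _ => (1 : K)) g)
        (fun S hS => by
          by_cases hS' : IsFace F σ n S
          · have hc : S.card ≠ k := fun hc => hS ⟨hS', hc⟩
            rw [Pi.sub_apply, hf S (fun h' => hc h'.2), differential_apply, zero_sub, neg_eq_zero]
            refine Finset.sum_eq_zero fun v _ => ?_
            rw [contract_apply]
            split_ifs with hv
            · simp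
            · rw [hg, smul_zero, smul_zero]
              rintro ⟨-, h'⟩
              rw [Finset.card_insert_of_notMem hv] at h'
              omega
          · rw [Pi.sub_apply, hgf S hS', sub_self])
        (by rw [map_sub, hd, differential_differential, sub_zero])
      refine ⟨g + g', fun S hS => ?_, by rw [map_add, hgf', add_sub_cancel]⟩
      rw [Pi.add_apply, hg S hS, hg' S fun h' => hS ⟨mono S h'.1, h'.2⟩, add_zero]
    -- the new faces form the interval from `A i ∩ σ` to `σ \ F i`
    have hnew : ∀ S, IsFace F σ (n + 1) S → ¬ IsFace F σ n S →
        S ⊆ σ ∧ F i ⊆ σ \ S ∧ A i ∩ σ ⊆ S := by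
      rintro S ⟨h1, l, hl, h2⟩ hS
      have hli : l = i := by
        refine Fin.ext ?_
        by_contra hne
        exact hS ⟨h1, l, by simp only [i] at hne; omega, h2⟩
      subst hli
      refine ⟨h1, h2, fun a ha => ?_⟩
      by_contra haS
      obtain ⟨haA, haσ⟩ := Finset.mem_inter.1 ha
      obtain ⟨j, hj, hjF⟩ := h.exists_subset_insert haA
      refine hS ⟨h1, j, hj, hjF.trans ?_⟩
      exact Finset.insert_subset (Finset.mem_sdiff.2 ⟨haσ, haS⟩) h2
    have hnew' : ∀ S, S ⊆ σ → F i ⊆ σ \ S → A i ∩ σ ⊆ S → ¬ IsFace F σ n S := by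
      rintro S - - h3 ⟨-, l, hl, h5⟩
      obtain ⟨a, haA, hal, -⟩ := h.inter_nonempty (show l < i from hl)
      have := Finset.mem_sdiff.1 (h5 hal)
      exact this.2 (h3 (Finset.mem_inter.2 ⟨haA, this.1⟩))
    -- If there is no such `v`, a new face must equal `σ \ F i`, which has more than `k` elements,
    -- so `f` already lives on the smaller complex.
    by_cases hv : ∃ v ∈ σ \ F i, v ∉ A i
    swap
    · refine ⟨0, fun _ _ => rfl, fun S hS => ?_⟩
      rw [map_zero, Pi.zero_apply, hf S]
      rintro ⟨h1, h2⟩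
      obtain ⟨h3, h4, h5⟩ := hnew S h1 hS
      push Not at hv
      have hsub : σ \ F i ⊆ S := fun v hv' =>
        h5 (Finset.mem_inter.2 ⟨hv v hv', (Finset.mem_sdiff.1 hv').1⟩)
      have := hk i (Nat.lt_succ_self n) (h4.trans Finset.sdiff_subset)
      have := Finset.card_le_card hsub
      omega
    · obtain ⟨v, hvσ, hvA⟩ := hv
      obtain ⟨hvσ, hvF⟩ := Finset.mem_sdiff.1 hvσ
      classical
      -- The part of `f` on new faces is a cycle relative to the smaller complex. Wedging with `v`
      -- bounds it there, since adding or removing `v` stays within the interval.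
      let f' : Finset V → K := fun S => if IsFace F σ n S then 0 else f S
      have hf' : ∀ S, ¬ IsFace F σ n S → f' S = f S := fun S hS => if_neg hS
      have hdf' : ∀ S, ¬ IsFace F σ n S → differential (fun _ => (1 : K)) f' S = 0 := by
        intro S hS
        rw [← show differential (fun _ => (1 : K)) f S = 0 by rw [hd]; rfl]
        refine Finset.sum_congr rfl fun w _ => ?_
        simp only [contract_apply]
        split_ifs
        · rfl
        · rw [hf' _ fun h' => hS (h'.subset (Finset.subset_insert w S))]
      have hwd : ∀ S, differential (fun _ => (1 : K)) (wedge v f') S +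
          wedge v (differential (fun _ => (1 : K)) f') S = f' S := by
        intro S
        have := differential_wedge (fun _ : V => (1 : K)) (fun _ => AddMonoidHom.id K) v
          (by simp) (by simp) f' S
        simpa using this
      have hg : ∀ S, ¬ (IsFace F σ (n + 1) S ∧ S.card = k + 1) → wedge v f' S = 0 := by
        intro S hS
        rw [wedge_apply]
        split_ifs with hvS
        · by_cases h1 : IsFace F σ n (S.erase v)
          · simp [f', h1]
          · rw [hf' _ h1, hf, smul_zero]
            rintro ⟨h2, h3⟩
            obtain ⟨h4, h5, h6⟩ := hnew _ h2 h1
            refine hS ⟨⟨?_, i, Nat.lt_succ_self n, ?_⟩, ?_⟩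
            · rw [← Finset.insert_erase hvS]
              exact Finset.insert_subset hvσ h4
            · intro a ha
              have h7 := Finset.mem_sdiff.1 (h5 ha)
              refine Finset.mem_sdiff.2 ⟨h7.1, fun haS => h7.2 (Finset.mem_erase.2 ⟨?_, haS⟩)⟩
              rintro rfl
              exact hvF ha
            · rw [← Finset.insert_erase hvS,
                Finset.card_insert_of_notMem (Finset.notMem_erase v S), h3]
        · rfl
      refine ⟨wedge v f', hg, fun S hS => ?_⟩
      by_cases h2 : IsFace F σ (n + 1) S
      · have h1 := hwd S
        rw [hf' S hS] at h1
        rw [← h1, left_eq_add, wedge_apply]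
        split_ifs with hvS
        · obtain ⟨h4, h5, h6⟩ := hnew _ h2 hS
          rw [hdf', smul_zero]
          refine hnew' _ ((Finset.erase_subset v S).trans h4)
            (h5.trans (Finset.sdiff_subset_sdiff subset_rfl (Finset.erase_subset v S))) ?_
          intro a ha
          refine Finset.mem_erase.2 ⟨?_, h6 ha⟩
          rintro rfl
          exact hvA (Finset.mem_inter.1 ha).1
        · rfl
      · rw [hf S fun h' => h2 h'.1]
        refine Finset.sum_eq_zero fun w _ => ?_
        rw [contract_eq_zero_of_subset_closed (P := IsFace F σ (n + 1))
          (fun _ _ h1 h2 => h1.subset h2) (fun T hT => hg T fun h' => hT h'.1) w S h2, smul_zero]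

end HasColonSets

/-! ### Squarefree monomial ideals with linear quotients -/

namespace MonomialIdeal

/-- The exponent vector of the squarefree monomial with support `F`. -/
noncomputable def expo {V : Type*} (F : Finset V) : V →₀ ℕ := Finsupp.indicator F fun _ _ => 1

theorem expo_apply {V : Type*} [DecidableEq V] (F : Finset V) (a : V) :
    expo F a = if a ∈ F then 1 else 0 := by
  rw [expo, Finsupp.indicator_apply]; split_ifs <;> rfl

theorem expo_apply_ne_zero {V : Type*} {F : Finset V} {a : V} : expo F a ≠ 0 ↔ a ∈ F := by
  classical
  rw [expo_apply]; split_ifs <;> simp_all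

theorem expo_le_iff {V : Type*} {F : Finset V} {e : V →₀ ℕ} :
    expo F ≤ e ↔ ∀ a ∈ F, e a ≠ 0 := by
  classical
  refine ⟨fun h a ha => ?_, fun h a => ?_⟩
  · have := h a
    rw [expo_apply, if_pos ha] at this
    omega
  · rw [expo_apply]
    split_ifs with ha
    · exact Nat.one_le_iff_ne_zero.2 (h a ha)
    · exact Nat.zero_le _

theorem expo_le_expo_iff {V : Type*} {F G : Finset V} : expo F ≤ expo G ↔ F ⊆ G := by
  simp_rw [expo_le_iff, expo_apply_ne_zero]; rfl

theorem prod_X_eq_monomial_expo {V K : Type*} [Field K] (F : Finset V) :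
    ∏ i ∈ F, (X i : MvPolynomial V K) = monomial (expo F) 1 := by
  classical
  have : expo F = ∑ i ∈ F, Finsupp.single i 1 := by
    ext a
    simp [expo_apply, Finsupp.single_apply]
  rw [this, monomial_sum_one]
  rfl

variable {V : Type*} {m : ℕ}

/-- The ideal generated by the first `n` of the squarefree monomials with supports `F i`. -/
noncomputable def genIdeal (K : Type*) [Field K] (F : Fin m → Finset V) (n : ℕ) : Ideal (MvPolynomial V K) :=
  Ideal.span ((fun e => monomial e (1 : K)) '' {e | ∃ l : Fin m, l.val < n ∧ e = expo (F l)})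

variable {K : Type*} [Field K] {F A : Fin m → Finset V}

theorem mem_genIdeal {n : ℕ} {p : MvPolynomial V K} :
    p ∈ genIdeal K F n ↔ ∀ e ∈ p.support, ∃ l : Fin m, l.val < n ∧ expo (F l) ≤ e := by
  rw [genIdeal, mem_ideal_span_monomial_image]
  refine forall₂_congr fun e _ => ⟨?_, ?_⟩
  · rintro ⟨_, ⟨l, hl, rfl⟩, h⟩
    exact ⟨l, hl, h⟩
  · rintro ⟨l, hl, h⟩
    exact ⟨_, ⟨l, hl, rfl⟩, h⟩

theorem genIdeal_zero : genIdeal K F 0 = ⊥ := by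
  simp [genIdeal]

theorem genIdeal_succ (i : Fin m) :
    genIdeal K F (i.val + 1) = genIdeal K F i.val ⊔ Ideal.span {monomial (expo (F i)) 1} := by
  have : {e | ∃ l : Fin m, l.val < i.val + 1 ∧ e = expo (F l)} =
      insert (expo (F i)) {e | ∃ l : Fin m, l.val < i.val ∧ e = expo (F l)} := by
    ext e
    constructor
    · rintro ⟨l, hl, rfl⟩
      rcases Nat.lt_succ_iff_lt_or_eq.1 hl with h | h
      · exact .inr ⟨l, h, rfl⟩
      · obtain rfl := Fin.ext h
        exact .inl rfl
    · rintro (rfl | ⟨l, hl, rfl⟩)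
      · exact ⟨i, Nat.lt_succ_self _, rfl⟩
      · exact ⟨l, by omega, rfl⟩
  rw [genIdeal, this, Set.image_insert_eq, Ideal.span_insert, sup_comm]
  rfl

theorem mul_monomial_mem_genIdeal {n : ℕ} {p : MvPolynomial V K} {e : V →₀ ℕ} :
    p * monomial e 1 ∈ genIdeal K F n ↔
      ∀ d ∈ p.support, ∃ l : Fin m, l.val < n ∧ expo (F l) ≤ d + e := by
  rw [mem_genIdeal]
  constructor
  · intro h d hd
    refine h _ ?_
    rw [mem_support_iff] at hd ⊢
    rwa [coeff_mul_monomial, mul_one]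
  · intro h d hd
    rw [mem_support_iff, coeff_mul_monomial'] at hd
    split_ifs at hd with hle
    · obtain ⟨l, hl, h'⟩ := h (d - e) (by rw [mem_support_iff]; simpa using hd)
      rw [tsub_add_cancel_of_le hle] at h'
      exact ⟨l, hl, h'⟩
    · exact absurd rfl hd

theorem mem_span_X_iff [DecidableEq V] (h : HasColonSets F A) (i : Fin m)
    (q : MvPolynomial V K) :
    q ∈ Ideal.span ((X : V → MvPolynomial V K) '' A i) ↔
      q * monomial (expo (F i)) 1 ∈ genIdeal K F i.val := by
  rw [mul_monomial_mem_genIdeal, mem_ideal_span_X_image]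
  refine forall₂_congr fun d _ => ⟨?_, ?_⟩
  · rintro ⟨a, ha, h0⟩
    obtain ⟨k, hk, hkF⟩ := h.exists_subset_insert ha
    refine ⟨k, hk, expo_le_iff.2 fun b hb => ?_⟩
    rw [Finsupp.add_apply, ne_eq, Nat.add_eq_zero_iff, not_and_or]
    rcases Finset.mem_insert.1 (hkF hb) with rfl | hb
    · exact .inl h0
    · exact .inr (expo_apply_ne_zero.2 hb)
  · rintro ⟨l, hl, hle⟩
    obtain ⟨a, ha, hal, hai⟩ := h.inter_nonempty (show l < i from hl)
    refine ⟨a, ha, ?_⟩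
    have h1 := expo_le_iff.1 hle a hal
    have h2 : expo (F i) a = 0 := by rw [expo_apply, if_neg hai]
    simpa [h2] using h1

theorem hasProjectiveDimensionLT_genIdeal [DecidableEq V] (h : HasColonSets F A) {r : ℕ}
    (hr : ∀ i, (A i).card ≤ r) (n : ℕ) (hn : n ≤ m) :
    HasProjectiveDimensionLT (ModuleCat.of (MvPolynomial V K) (genIdeal K F n)) (r + 1) := by
  induction n with
  | zero =>
    have : Subsingleton (genIdeal K F 0) := by rw [genIdeal_zero]; infer_instance
    have := (ModuleCat.isZero_of_subsingleton
      (ModuleCat.of (MvPolynomial V K) (genIdeal K F 0))).hasProjectiveDimensionLT_zero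
    exact hasProjectiveDimensionLT_of_ge _ 0 _ (Nat.zero_le _)
  | succ n ih =>
    rw [genIdeal_succ ⟨n, hn⟩]
    refine hasProjectiveDimensionLT_sup_span _ _ _ (mem_span_X_iff h ⟨n, hn⟩) _ ?_
      (ih (by omega))
    have := hasProjectiveDimensionLT_span_X (K := K) (A ⟨n, hn⟩)
    exact hasProjectiveDimensionLT_of_ge _ _ _ (hr ⟨n, hn⟩)

/-- Generators are removed from the end; each colon ideal meets the bound because it is generated by
at most `r` variables. -/
theorem hasProjectiveDimensionLT_genIdeal_of_le [DecidableEq V] (h : HasColonSets F A) {r : ℕ}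
    (hr : ∀ i, (A i).card ≤ r) {n k n' : ℕ} (hk : n + k = n') (hn' : n' ≤ m)
    (hpd : HasProjectiveDimensionLT (ModuleCat.of (MvPolynomial V K) (genIdeal K F n')) r) :
    HasProjectiveDimensionLT (ModuleCat.of (MvPolynomial V K) (genIdeal K F n)) r := by
  subst hk
  induction k with
  | zero => exact hpd
  | succ k ih =>
    refine ih (by omega) ?_
    have h1 : n + k < m := by omega
    rw [← add_assoc, genIdeal_succ ⟨n + k, h1⟩] at hpd
    refine hasProjectiveDimensionLT_of_sup_span _ _ _ (mem_span_X_iff h ⟨n + k, h1⟩) _ ?_ hpd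
    have := hasProjectiveDimensionLT_span_X (K := K) (A ⟨n + k, h1⟩)
    exact hasProjectiveDimensionLT_of_ge _ _ _ (hr ⟨n + k, h1⟩)

open Koszul

/-- The strand of multidegree `σ` of the Koszul complex is a simplicial chain complex, because `x^{σ
\ S} = x_v x^{σ \ (S ∪ v)}`. -/
theorem differential_monomial_expo [LinearOrder V] [Fintype V] (σ : Finset V) (z : Finset V → K)
    (hz : ∀ S, ¬ S ⊆ σ → z S = 0) :
    differential (X (R := K)) (fun S => monomial (expo (σ \ S)) (z S)) =
      fun S => monomial (expo (σ \ S)) (differential (fun _ => (1 : K)) z S) := by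
  ext1 S
  rw [differential_apply, differential_apply, map_sum]
  refine Finset.sum_congr rfl fun v _ => ?_
  simp only [contract_apply]
  split_ifs with hv
  · simp
  by_cases hS : insert v S ⊆ σ
  · have : expo (σ \ S) = Finsupp.single v 1 + expo (σ \ insert v S) := by
      ext a
      have hvσ := hS (Finset.mem_insert_self v S)
      by_cases hav : a = v
      · subst hav; simp [expo_apply, hv, hvσ]
      · simp [expo_apply, hav]
    rw [this, one_smul, smul_eq_mul, X, ← map_zsmul, monomial_mul, one_mul]
  · simp [hz _ hS]

/-- In a family sorted by cardinality, the simplicial boundary of `A i` bounds in the Koszul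
complex of the earlier members. -/
theorem exists_cycle [LinearOrder V] [Fintype V] (h : HasColonSets F A) (i : Fin m)
    (hsort : ∀ l < i, (F l).card ≤ (F i).card) (hA : (A i).Nonempty) :
    ∃ z : Finset V → K, z (A i) = 1 ∧ differential (fun _ => (1 : K)) z = 0 ∧
      ∀ S, ¬ (HasColonSets.IsFace F (F i ∪ A i) (i.val + 1) S ∧ S.card = (A i).card) →
        z S = 0 := by
  set σ := F i ∪ A i with hσ
  have hdisj : Disjoint (F i) (A i) :=
    Finset.disjoint_left.2 fun a ha ha' => h.notMem ha' ha
  have hσA : σ \ A i = F i := by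
    rw [hσ, Finset.union_sdiff_right, Finset.sdiff_eq_self_iff_disjoint.2 hdisj]
  let δ : Finset V → K := Pi.single (A i) 1
  have hδ : ∀ S, S ≠ A i → δ S = 0 := fun S hS => by simp [δ, hS]
  have hcard : 0 < (A i).card := hA.card_pos
  obtain ⟨g, hg, hgd⟩ := h.exists_boundary σ ((A i).card - 1) i.val i.2.le
    -- Sortedness enters here: `|σ \ F l| = |F i| + |A i| - |F l| ≥ |A i|`.
    (fun l hl hlσ => by
      have h1 := hsort l hl
      have h2 : σ.card = (F i).card + (A i).card := Finset.card_union_of_disjoint hdisj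
      rw [Finset.card_sdiff_of_subset hlσ]
      omega)
    (differential (fun _ => (1 : K)) δ)
    (fun S hS => by
      refine Finset.sum_eq_zero fun v _ => ?_
      rw [contract_apply]
      split_ifs with hv
      · exact smul_zero _
      rw [hδ, smul_zero, smul_zero]
      intro hvS
      have hvA : v ∈ A i := hvS ▸ Finset.mem_insert_self v S
      obtain ⟨k, hk, hkF⟩ := h.exists_subset_insert hvA
      have hSA : S ⊆ A i := hvS ▸ Finset.subset_insert v S
      refine hS ⟨⟨hSA.trans Finset.subset_union_right, k, hk, hkF.trans ?_⟩, ?_⟩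
      · refine Finset.insert_subset
          (Finset.mem_sdiff.2 ⟨Finset.mem_union_right _ hvA, hv⟩) ?_
        rw [← hσA]
        exact Finset.sdiff_subset_sdiff subset_rfl hSA
      · rw [← hvS, Finset.card_insert_of_notMem hv]; rfl)
    (differential_differential _ _)
  refine ⟨δ - g, ?_, by rw [map_sub, hgd, sub_self], fun S hS => ?_⟩
  · rw [Pi.sub_apply, hg]
    · simp [δ]
    · rintro ⟨⟨-, l, hl, hlF⟩, -⟩
      obtain ⟨a, -, hal, hai⟩ := h.inter_nonempty (show l < i from hl)
      rw [hσA] at hlF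
      exact hai (hlF hal)
  · rw [Pi.sub_apply, hδ, hg, sub_zero]
    · rintro ⟨⟨h1, l, hl, hlF⟩, h2⟩
      exact hS ⟨⟨h1, l, by omega, hlF⟩, by omega⟩
    · rintro rfl
      exact hS ⟨⟨Finset.subset_union_right, i, Nat.lt_succ_self _, hσA.ge⟩, rfl⟩

/-- The cycle from `exists_cycle` has coefficient `x^{F i}` at `A i`. A boundary with coefficients
in the ideal cannot: some `x^{F l}` would divide `x^{F i} / x_v`, against the antichain condition.
-/
theorem not_hasProjectiveDimensionLT_genIdeal [LinearOrder V] [Fintype V]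
    (h : HasColonSets F A) (hF : ∀ i j, F i ⊆ F j → i = j) (i : Fin m)
    (hsort : ∀ l < i, (F l).card ≤ (F i).card) :
    ¬ HasProjectiveDimensionLT
      (ModuleCat.of (MvPolynomial V K) (genIdeal K F (i.val + 1))) (A i).card := by
  intro hpd
  have hmem : monomial (expo (F i)) (1 : K) ∈ genIdeal K F (i.val + 1) := by
    rw [genIdeal_succ]
    exact Ideal.mem_sup_right (Ideal.mem_span_singleton_self _)
  rcases (A i).eq_empty_or_nonempty with hA | hA
  · rw [hA, Finset.card_empty] at hpd
    have h0 := isZero_of_hasProjectiveDimensionLT_zero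
      (ModuleCat.of (MvPolynomial V K) (genIdeal K F (i.val + 1)))
    rw [ModuleCat.isZero_iff_subsingleton] at h0
    have := congrArg Subtype.val (h0.elim (⟨_, hmem⟩ : genIdeal K F (i.val + 1)) 0)
    simp [monomial_eq_zero] at this
  · obtain ⟨z, hzA, hzd, hz⟩ := exists_cycle (K := K) h i hsort hA
    set σ := F i ∪ A i with hσ
    have hσA : σ \ A i = F i := by
      rw [hσ, Finset.union_sdiff_right, Finset.sdiff_eq_self_iff_disjoint.2
        (Finset.disjoint_left.2 fun a ha ha' => h.notMem ha' ha)]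
    have hzmem : ∀ S, monomial (expo (σ \ S)) (z S) ∈ genIdeal K F (i.val + 1) := fun S => by
      by_cases hS : HasColonSets.IsFace F σ (i.val + 1) S ∧ S.card = (A i).card
      · obtain ⟨⟨-, l, hl, hlF⟩, -⟩ := hS
        refine mem_genIdeal.2 fun e he => ⟨l, hl, ?_⟩
        rw [Finset.mem_singleton.1 (support_monomial_subset he), expo_le_expo_iff]
        exact hlF
      · simp [hz S hS]
    let c : Finset V → genIdeal K F (i.val + 1) := fun S => ⟨_, hzmem S⟩
    have hc : (Submodule.subtype (genIdeal K F (i.val + 1))) ∘ c =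
      fun S => monomial (expo (σ \ S)) (z S) := rfl
    obtain ⟨n, hn⟩ := Nat.exists_eq_succ_of_ne_zero hA.card_pos.ne'
    rw [hn] at hpd
    obtain ⟨y, hy⟩ := exists_differential_eq_of_hasProjectiveDimensionLT n _ c
      (by
        have h1 := differential_comp (X (R := K)) (Submodule.subtype (genIdeal K F (i.val + 1))) c
        rw [hc, differential_monomial_expo σ z fun S hS => hz S fun h' => hS h'.1.1, hzd] at h1
        ext1 S
        refine Subtype.ext ?_
        rw [← Submodule.subtype_apply, ← Function.comp_apply
          (f := Submodule.subtype (genIdeal K F (i.val + 1))), ← h1]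
        simp)
      (fun S hS => Subtype.ext (by
        show monomial _ (z S) = 0
        rw [hz S (by rintro ⟨-, h'⟩; omega), map_zero]))
    have h1 := congrFun (differential_comp (X (R := K))
      (Submodule.subtype (genIdeal K F (i.val + 1))) y) (A i)
    rw [hy, hc] at h1
    beta_reduce at h1
    rw [hσA, hzA, differential_apply] at h1
    have h2 := congrArg (coeff (expo (F i))) h1
    rw [coeff_sum, coeff_monomial, if_pos rfl] at h2
    refine one_ne_zero (h2.symm.trans (Finset.sum_eq_zero fun v _ => ?_))
    rw [contract_apply]
    split_ifs with hv
    · simp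
    rw [smul_eq_mul, coeff_X_mul']
    split_ifs with hvF
    swap
    · rfl
    rw [coeff_smul]
    have hyv : coeff (expo (F i) - Finsupp.single v 1)
        (y (insert v (A i)) : MvPolynomial V K) = 0 := by
      by_contra hne
      obtain ⟨l, -, hl⟩ := mem_genIdeal.1 (y (insert v (A i))).2 _ (mem_support_iff.2 hne)
      obtain rfl := hF l i (expo_le_expo_iff.1 (hl.trans tsub_le_self))
      have hvF' : v ∈ F l := expo_apply_ne_zero.1 (Finsupp.mem_support_iff.1 hvF)
      have := hl v
      rw [Finsupp.tsub_apply, expo_apply, if_pos hvF', Finsupp.single_eq_same] at this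
      omega
    exact (congrArg _ hyv).trans (smul_zero _)

/-- The projective dimension of an ideal generated by an antichain of squarefree monomials that
has linear quotients and is sorted by degree. -/
theorem pd_genIdeal_of_sorted [Finite V] [DecidableEq V]
    (h : HasColonSets F A) (hF : ∀ i j, F i ⊆ F j → i = j)
    (hsort : ∀ l i, l < i → (F l).card ≤ (F i).card) {r : ℕ}
    (hr : ∀ i, (A i).card ≤ r) (hr' : ∃ i, (A i).card = r) :
    pd (genIdeal K F m) = r := by
  refine le_antisymm ?_ ?_
  · exact (projectiveDimension_le_iff _ _).2 (hasProjectiveDimensionLT_genIdeal h hr m le_rfl)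
  · refine (projectiveDimension_ge_iff _ _).2 fun hpd => ?_
    obtain ⟨i, hi⟩ := hr'
    have hm : i.val + 1 + (m - (i.val + 1)) = m := by omega
    have h1 := hasProjectiveDimensionLT_genIdeal_of_le h hr hm le_rfl hpd
    have := Fintype.ofFinite V
    -- Any order on the vertices serves; it only fixes the Koszul signs.
    let : LinearOrder V := LinearOrder.lift' (Fintype.equivFin V) (Fintype.equivFin V).injective
    rw [← hi] at h1
    refine not_hasProjectiveDimensionLT_genIdeal ?_ hF i (fun l hl => hsort l i hl) h1
    convert h

end MonomialIdeal

/-! ### Reordering the generators by degree -/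

namespace HasColonSets

variable {V ι : Type*} [DecidableEq V]

/-- Linear quotients persist when a smaller set `F j` is moved in front of `F i`. -/
theorem inter_nonempty_of_card_lt [LinearOrder ι] [WellFoundedLT ι] {F A : ι → Finset V}
    (h : HasColonSets F A) (hF : ∀ i j, F i ⊆ F j → i = j) {i j : ι} (hij : i < j)
    (hcard : (F j).card < (F i).card) : ∃ a ∈ A i, a ∈ F j ∧ a ∉ F i := by
  induction j using WellFoundedLT.induction with
  | ind j ih =>
    by_contra! hno
    -- Exchanging towards `F i` gives `F k ⊆ insert a (F j)` with `k < j`. Since `a ∈ F i`, the set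
    -- `F k` is a counterexample too; by the antichain condition it is no larger than `F j`, so each
    -- position of `k` relative to `i` is contradictory.
    obtain ⟨a, haA, hai, haj⟩ := h.inter_nonempty hij
    obtain ⟨k, hk, hkF⟩ := h.exists_subset_insert haA
    have hno' : ¬ ∃ b ∈ A i, b ∈ F k ∧ b ∉ F i := by
      rintro ⟨b, hbA, hbk, hbi⟩
      rcases Finset.mem_insert.1 (hkF hbk) with rfl | hb
      · exact hbi hai
      · exact hbi (hno b hbA hb)
    have hkj : (F k).card ≤ (F j).card := by
      by_contra! hlt
      have h1 : F k = insert a (F j) := Finset.eq_of_subset_of_card_le hkF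
        (by rw [Finset.card_insert_of_notMem haj]; omega)
      exact hk.ne' (hF j k (h1 ▸ Finset.subset_insert a (F j)))
    rcases lt_trichotomy i k with hik | rfl | hki
    · exact hno' (ih k hk hik (by omega))
    · omega
    · exact hno' (h.inter_nonempty hki)

theorem comp_orderIso {κ : Type*} [Preorder ι] [Preorder κ] {F A : ι → Finset V}
    (h : HasColonSets F A) (e : κ ≃o ι) : HasColonSets (F ∘ e) (A ∘ e) where
  inter_nonempty _ _ hij := h.inter_nonempty (e.lt_iff_lt.2 hij)
  notMem _ _ ha := h.notMem ha
  exists_subset_insert i a ha := by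
    obtain ⟨k, hk, hkF⟩ := h.exists_subset_insert (i := e i) ha
    exact ⟨e.symm k, by rwa [← e.lt_iff_lt, e.apply_symm_apply],
      by simpa using hkF⟩

end HasColonSets

namespace MonomialIdeal

variable {V ι K : Type*} [Finite V] [DecidableEq V] [Finite ι] [Field K]

theorem pd_span_prod_X_of_sorted [LinearOrder ι] {F A : ι → Finset V}
    (h : HasColonSets F A) (hF : ∀ i j, F i ⊆ F j → i = j)
    (hsort : ∀ l i, l < i → (F l).card ≤ (F i).card) {r : ℕ}
    (hr : ∀ i, (A i).card ≤ r) (hr' : ∃ i, (A i).card = r) :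
    pd (Ideal.span ((fun F : Finset V => ∏ i ∈ F, (X i : MvPolynomial V K)) '' Set.range F)) =
      r := by
  have := Fintype.ofFinite ι
  let e : Fin (Fintype.card ι) ≃o ι := Fintype.orderIsoFinOfCardEq ι rfl
  have key := pd_genIdeal_of_sorted (K := K) (h.comp_orderIso e)
    (fun i j hij => e.injective (hF _ _ hij)) (fun l i hl => hsort _ _ (e.lt_iff_lt.2 hl))
    (fun i => hr (e i)) (by
      obtain ⟨i, hi⟩ := hr'
      exact ⟨e.symm i, by simpa using hi⟩)
  rw [← key, genIdeal]
  congr 2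
  ext p
  constructor
  · rintro ⟨_, ⟨i, rfl⟩, rfl⟩
    exact ⟨_, ⟨e.symm i, (e.symm i).2, rfl⟩, by simp [prod_X_eq_monomial_expo]⟩
  · rintro ⟨_, ⟨l, -, rfl⟩, rfl⟩
    exact ⟨_, ⟨e l, rfl⟩, by simp [prod_X_eq_monomial_expo]⟩

/-- The projective dimension of an ideal generated by an antichain of squarefree monomials that
has linear quotients is the largest number of variables generating one of the colon ideals. -/
theorem pd_span_prod_X [LinearOrder ι] {F A : ι → Finset V}
    (h : HasColonSets F A) (hF : ∀ i j, F i ⊆ F j → i = j) {r : ℕ}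
    (hr : ∀ i, (A i).card ≤ r) (hr' : ∃ i, (A i).card = r) :
    pd (Ideal.span ((fun F : Finset V => ∏ i ∈ F, (X i : MvPolynomial V K)) '' Set.range F)) =
      r := by
  let before (i j : ι) : Prop := (F i).card < (F j).card ∨ (F i).card = (F j).card ∧ i < j
  have h₁ : ∀ i j, before j i → ∃ a ∈ A i, a ∈ F j ∧ a ∉ F i := by
    intro i j hji
    rcases lt_trichotomy j i with h1 | rfl | h1
    · exact h.inter_nonempty h1
    · rcases hji with h2 | h2
      · exact absurd h2 (lt_irrefl _)
      · exact absurd h2.2 (lt_irrefl _)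
    · refine h.inter_nonempty_of_card_lt hF h1 ?_
      rcases hji with h2 | h2
      · exact h2
      · exact absurd h2.2 h1.not_gt
  have h₂ : ∀ i, ∀ a ∈ A i, ∃ k, before k i ∧ F k ⊆ insert a (F i) := by
    intro i a ha
    obtain ⟨k, hk, hkF⟩ := h.exists_subset_insert ha
    refine ⟨k, ?_, hkF⟩
    -- `F k` has at most one element more than `F i`, and exactly one more would force `F i ⊆ F k`.
    -- So `k` still comes before `i` in the new order.
    have h1 := Finset.card_le_card hkF
    rw [Finset.card_insert_of_notMem (h.notMem ha)] at h1
    rcases h1.lt_or_eq with h2 | h2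
    · rcases (Nat.lt_succ_iff.1 h2).lt_or_eq with h3 | h3
      · exact .inl h3
      · exact .inr ⟨h3, hk⟩
    · have h3 : F k = insert a (F i) := Finset.eq_of_subset_of_card_le hkF
        (by rw [Finset.card_insert_of_notMem (h.notMem ha)]; omega)
      exact absurd (hF i k (h3 ▸ Finset.subset_insert a (F i))) hk.ne'
  have h₃ := h.notMem
  obtain ⟨o, ho⟩ : ∃ o : LinearOrder ι, ∀ i j, o.lt i j ↔ before i j :=
    ⟨LinearOrder.lift' (fun i => toLex ((F i).card, i))
      (fun i j hij => congrArg Prod.snd (toLex.injective hij)),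
      fun i j => Prod.Lex.toLex_lt_toLex⟩
  refine @pd_span_prod_X_of_sorted V ι K _ _ _ _ o F A ?_ hF ?_ r hr hr'
  · refine @HasColonSets.mk V ι _ o.toLT F A (fun i j hji => h₁ i j ((ho j i).1 hji)) h₃ ?_
    intro i a ha
    obtain ⟨k, hk, hkF⟩ := h₂ i a ha
    exact ⟨k, (ho k i).2 hk, hkF⟩
  · intro l i hl
    rcases (ho l i).1 hl with h1 | h1
    · exact h1.le
    · exact h1.1.le

end MonomialIdeal

/-! ### From linear quotients of the facet ideal to colon sets -/

namespace FaceComplex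

open MonomialIdeal

variable {V K : Type*} [Field K] (Δ : FaceComplex V)

theorem monomial_mem_facetIdeal {e : V →₀ ℕ} :
    monomial e (1 : K) ∈ Δ.facetIdeal K ↔ ∃ F ∈ Δ.facets, expo F ≤ e := by
  have : (fun F : Finset V => ∏ i ∈ F, (X i : MvPolynomial V K)) '' Δ.facets =
      (fun e => monomial e (1 : K)) '' (expo '' Δ.facets) := by
    rw [Set.image_image]
    exact Set.image_congr fun F _ => prod_X_eq_monomial_expo F
  rw [facetIdeal, this, mem_ideal_span_monomial_image]
  classical
  simp [support_monomial]

theorem expo_injective : Function.Injective (expo : Finset V → (V →₀ ℕ)) := fun _ _ h =>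
  (expo_le_expo_iff.1 h.le).antisymm (expo_le_expo_iff.1 h.ge)

theorem eq_of_subset_of_mem_facets {F G : Finset V} (hF : F ∈ Δ.facets) (hG : G ∈ Δ.facets)
    (h : F ⊆ G) : F = G :=
  hF.eq_of_le hG.1 h

theorem minGens_facetIdeal : minGens (Δ.facetIdeal K) = expo '' Δ.facets := by
  ext e
  constructor
  · intro (he : Minimal (fun e => monomial e (1 : K) ∈ Δ.facetIdeal K) e)
    obtain ⟨F, hF, hle⟩ := Δ.monomial_mem_facetIdeal.1 he.1
    exact ⟨F, hF, he.eq_of_le (Δ.monomial_mem_facetIdeal.2 ⟨F, hF, le_rfl⟩) hle⟩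
  · rintro ⟨F, hF, rfl⟩
    refine ⟨Δ.monomial_mem_facetIdeal.2 ⟨F, hF, le_rfl⟩, fun e' he' hle => ?_⟩
    obtain ⟨G, hG, hGe⟩ := Δ.monomial_mem_facetIdeal.1 he'
    rwa [← Δ.eq_of_subset_of_mem_facets hG hF (expo_le_expo_iff.1 (hGe.trans hle))]

/-- The colon identities are tested on monomials: `x_a` yields the exchange property, and `x^{F j \
F i}` yields a colon variable in `F j \ F i`. -/
theorem exists_hasColonSets [Finite V] [DecidableEq V]
    (h : HasLinearQuotients (Δ.facetIdeal K)) :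
    ∃ (m : ℕ) (F A : Fin m → Finset V), HasColonSets F A ∧ Function.Injective F ∧
      Set.range F = Δ.facets := by
  obtain ⟨m, f, hinj, hrange, hcolon⟩ := h
  rw [minGens_facetIdeal] at hrange
  have hex : ∀ i, ∃ F ∈ Δ.facets, expo F = f i := fun i => by
    have : f i ∈ expo '' Δ.facets := hrange ▸ Set.mem_range_self i
    exact this
  choose F hF hFf using hex
  choose A hA using hcolon
  have hFinj : Function.Injective F := fun i j hij => hinj (by rw [← hFf, ← hFf, hij])
  refine ⟨m, F, fun i => (A i).toFinite.toFinset, ?_, hFinj, ?_⟩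
  swap
  · ext G
    constructor
    · rintro ⟨i, rfl⟩
      exact hF i
    · intro hG
      obtain ⟨i, hi⟩ : expo G ∈ Set.range f := hrange ▸ ⟨G, hG, rfl⟩
      exact ⟨i, expo_injective ((hFf i).trans hi)⟩
  have hgen : ∀ i, Ideal.span ((fun j => monomial (f j) (1 : K)) '' {j | j < i}) =
      genIdeal K F i.val := fun i => by
    rw [genIdeal]
    congr 1
    ext p
    constructor
    · rintro ⟨j, hj, rfl⟩
      exact ⟨f j, ⟨j, hj, (hFf j).symm⟩, rfl⟩
    · rintro ⟨_, ⟨j, hj, rfl⟩, rfl⟩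
      exact ⟨j, hj, by simp [hFf]⟩
  have hmem : ∀ i (q : MvPolynomial V K), (∀ d ∈ q.support, ∃ a ∈ A i, d a ≠ 0) ↔
      ∀ d ∈ q.support, ∃ l : Fin m, l.val < i.val ∧ expo (F l) ≤ d + expo (F i) := by
    intro i q
    rw [← mem_ideal_span_X_image, ← hA i, ← mul_monomial_mem_genIdeal, hgen i, hFf i]
    rw [Submodule.mem_colon]
    constructor
    · intro h
      exact h _ (Ideal.mem_span_singleton_self _)
    · intro h p hp
      obtain ⟨c, rfl⟩ := Ideal.mem_span_singleton'.1 hp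
      rw [smul_eq_mul, mul_left_comm]
      exact Ideal.mul_mem_left _ _ h
  have hmon : ∀ i d, (∃ a ∈ A i, d a ≠ 0) ↔
      ∃ l : Fin m, l.val < i.val ∧ expo (F l) ≤ d + expo (F i) := by
    classical
    intro i d
    have := hmem i (monomial d 1)
    simpa [support_monomial] using this
  have hsub : ∀ i l : Fin m, l < i → ¬ F l ⊆ F i := fun i l hl hs =>
    hl.ne (hFinj (Δ.eq_of_subset_of_mem_facets (hF l) (hF i) hs))
  have hC : ∀ i, ∀ a ∈ A i, ∃ k < i, F k ⊆ insert a (F i) := by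
    intro i a ha
    obtain ⟨k, hk, hle⟩ := (hmon i (expo {a})).1
      ⟨a, ha, expo_apply_ne_zero.2 (Finset.mem_singleton_self a)⟩
    refine ⟨k, hk, fun b hb => ?_⟩
    have hb' := expo_le_iff.1 hle b hb
    rw [Finsupp.add_apply, ne_eq, Nat.add_eq_zero_iff, not_and_or] at hb'
    rcases hb' with hb' | hb'
    · exact Finset.mem_insert.2 (.inl (Finset.mem_singleton.1 (expo_apply_ne_zero.1 hb')))
    · exact Finset.mem_insert_of_mem (expo_apply_ne_zero.1 hb')
  refine ⟨fun i j hj => ?_, fun i a ha hai => ?_, fun i a ha => ?_⟩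
  · obtain ⟨a, ha, h0⟩ := (hmon i (expo (F j \ F i))).2 ⟨j, hj, expo_le_iff.2 fun b hb => by
      rw [Finsupp.add_apply, ne_eq, Nat.add_eq_zero_iff, not_and_or]
      by_cases hbi : b ∈ F i
      · exact .inr (expo_apply_ne_zero.2 hbi)
      · exact .inl (expo_apply_ne_zero.2 (Finset.mem_sdiff.2 ⟨hb, hbi⟩))⟩
    exact ⟨a, by simpa using ha, Finset.mem_sdiff.1 (expo_apply_ne_zero.1 h0)⟩
  · obtain ⟨k, hk, hs⟩ := hC i a (by simpa using ha)
    rw [Finset.insert_eq_of_mem hai] at hs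
    exact hsub i k hk hs
  · exact hC i a (by simpa using ha)

end FaceComplex

/-! ### Facets of the expansion -/

namespace FaceComplex

variable {V : Type*} {α : V → ℕ}

theorem mem_transversal {F : Finset V} {j : (i : F) → Fin (α i)} {p : Σ i : V, Fin (α i)} :
    p ∈ transversal α F j ↔ ∃ h : p.1 ∈ F, j ⟨p.1, h⟩ = p.2 := by
  simp only [transversal, Finset.mem_map, Finset.mem_univ, true_and]
  constructor
  · rintro ⟨x, rfl⟩
    exact ⟨x.2, rfl⟩
  · rintro ⟨h, hj⟩
    exact ⟨⟨p.1, h⟩, Sigma.ext rfl (heq_of_eq hj)⟩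

theorem subset_of_transversal_subset {F F' : Finset V} {j : (i : F) → Fin (α i)}
    {j' : (i : F') → Fin (α i)} (h : transversal α F j ⊆ transversal α F' j') : F ⊆ F' :=
  fun x hx => (mem_transversal.1 (h ((mem_transversal (p := ⟨x, j ⟨x, hx⟩⟩)).2 ⟨hx, rfl⟩))).1

theorem eq_of_transversal_subset {F : Finset V} {j j' : (i : F) → Fin (α i)}
    (h : transversal α F j ⊆ transversal α F j') : j = j' := by
  ext1 x
  have hx : (⟨x.1, j x⟩ : Σ i : V, Fin (α i)) ∈ transversal α F j := mem_transversal.2 ⟨x.2, rfl⟩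
  exact (mem_transversal.1 (h hx)).2.symm

theorem facets_expansion (Δ : FaceComplex V) (hα : ∀ v, 0 < α v) :
    (Δ.expansion α).facets = {G | ∃ F ∈ Δ.facets, ∃ j, G = transversal α F j} := by
  classical
  ext G
  constructor
  · intro (hG : Maximal (· ∈ (Δ.expansion α).faces) G)
    obtain ⟨F, hF, j, hGF⟩ := hG.1
    obtain rfl : G = transversal α F j := hG.eq_of_le ⟨F, hF, j, subset_rfl⟩ hGF
    refine ⟨F, ⟨hF, fun F' hF' hle => ?_⟩, j, rfl⟩
    -- Extend the choice of copies to the larger face; the value outside `F` is immaterial.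
    let j' : (i : F') → Fin (α i) := fun x => if h : x.1 ∈ F then j ⟨x, h⟩ else ⟨0, hα x⟩
    refine subset_of_transversal_subset (j := j') (j' := j) (hG.2 ⟨F', hF', j', subset_rfl⟩ ?_)
    intro p hp
    obtain ⟨h, hj⟩ := mem_transversal.1 hp
    exact mem_transversal.2 ⟨hle h, by simp [j', h, hj]⟩
  · rintro ⟨F, hF, j, rfl⟩
    refine ⟨⟨F, hF.1, j, subset_rfl⟩, ?_⟩
    rintro G ⟨F', hF', j', hG⟩ hle
    obtain rfl := hF.eq_of_le hF' (subset_of_transversal_subset (hle.trans hG))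
    obtain rfl := eq_of_transversal_subset (hle.trans hG)
    exact hG

end FaceComplex

/-! ### Linear quotients of the expansion -/

namespace HasColonSets

open FaceComplex

variable {V ι : Type*} [DecidableEq V] [Fintype V] {α : V → ℕ} {F A : ι → Finset V}

/-- The colon sets of the expansion: all copies of the vertices in `A i`, and for each vertex in
`F i` the copies preceding the chosen one. -/
def expansionColon (α : V → ℕ) (F A : ι → Finset V) (p : Σ i, (x : F i) → Fin (α x)) :
    Finset (Σ v : V, Fin (α v)) :=
  Finset.univ.sigma fun v =>
    if v ∈ A p.1 then Finset.univ else if h : v ∈ F p.1 then Finset.Iio (p.2 ⟨v, h⟩) else ∅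

theorem mem_expansionColon {p : Σ i, (x : F i) → Fin (α x)} {q : Σ v : V, Fin (α v)} :
    q ∈ expansionColon α F A p ↔ q.1 ∈ A p.1 ∨ ∃ h : q.1 ∈ F p.1, q.2 < p.2 ⟨q.1, h⟩ := by
  simp only [expansionColon, Finset.mem_sigma, Finset.mem_univ, true_and]
  by_cases h1 : q.1 ∈ A p.1
  · simp [h1]
  · by_cases h2 : q.1 ∈ F p.1 <;> simp [h1, h2]

theorem card_expansionColon (p : Σ i, (x : F i) → Fin (α x)) :
    (expansionColon α F A p).card = ∑ v, if v ∈ A p.1 then α v else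
      if h : v ∈ F p.1 then (p.2 ⟨v, h⟩).val else 0 := by
  rw [expansionColon, Finset.card_sigma]
  refine Finset.sum_congr rfl fun v _ => ?_
  split_ifs <;> simp

/-- Linear quotients pass to expansions. -/
theorem exists_linearOrder_expansion [LinearOrder ι] [Finite ι] (h : HasColonSets F A)
    (hα : ∀ v, 0 < α v) :
    ∃ o : LinearOrder (Σ i, (x : F i) → Fin (α x)),
      @HasColonSets _ _ _ o.toLT
        (fun p : Σ i, (x : F i) → Fin (α x) => transversal α (F p.1) p.2)
        (expansionColon α F A) := by
  have := Fintype.ofFinite (Σ i, (x : F i) → Fin (α x))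
  let w (p : Σ i, (x : F i) → Fin (α x)) : ℕ := ∑ x, (p.2 x).val
  let N := Fintype.equivFin (Σ i, (x : F i) → Fin (α x))
  let o : LinearOrder (Σ i, (x : F i) → Fin (α x)) :=
    -- Compare the facet, then the weight; the enumeration `N` only breaks ties.
    LinearOrder.lift' (fun p => toLex (p.1, toLex (w p, N p))) (fun p q hpq =>
      N.injective (congrArg (fun z => (ofLex (ofLex z).2).2) hpq))
  have ho : ∀ p q, o.lt p q ↔ p.1 < q.1 ∨ p.1 = q.1 ∧ (w p < w q ∨ w p = w q ∧ N p < N q) := by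
    intro p q
    refine Prod.Lex.toLex_lt_toLex.trans ?_
    simp only [Prod.Lex.toLex_lt_toLex]
  refine ⟨o, @HasColonSets.mk _ _ _ o.toLT _ _ ?_ ?_ ?_⟩
  · rintro q p hpq
    rcases (ho p q).1 hpq with h1 | ⟨h1, h2⟩
    · obtain ⟨a, haA, hap, haq⟩ := h.inter_nonempty h1
      exact ⟨⟨a, p.2 ⟨a, hap⟩⟩, mem_expansionColon.2 (.inl haA),
        mem_transversal.2 ⟨hap, rfl⟩, fun h' => haq (mem_transversal.1 h').1⟩
    · obtain ⟨i, j⟩ := p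
      obtain ⟨i', j'⟩ := q
      obtain rfl : i = i' := h1
      -- Otherwise `j' ≤ j` pointwise; as `j` has no larger weight, the two coincide.
      have hx : ∃ x, j x < j' x := by
        by_contra! hle
        have hw : w ⟨i, j'⟩ ≤ w ⟨i, j⟩ := Finset.sum_le_sum fun x _ => hle x
        have heq : w ⟨i, j'⟩ = w ⟨i, j⟩ := by
          rcases h2 with h2 | h2 <;> omega
        have hj : j' = j := by
          ext1 x
          exact Fin.ext ((Finset.sum_eq_sum_iff_of_le fun x _ => hle x).1 heq x
            (Finset.mem_univ x))
        subst hj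
        rcases h2 with h2 | h2
        · exact lt_irrefl _ h2
        · exact lt_irrefl _ h2.2
      obtain ⟨x, hx⟩ := hx
      refine ⟨⟨x, j x⟩, mem_expansionColon.2 (.inr ⟨x.2, hx⟩), mem_transversal.2 ⟨x.2, rfl⟩,
        fun h' => ?_⟩
      obtain ⟨_, h3⟩ := mem_transversal.1 h'
      exact hx.ne' h3
  · rintro p q hq hq'
    obtain ⟨h1, h2⟩ := mem_transversal.1 hq'
    rcases mem_expansionColon.1 hq with h3 | ⟨h3, h4⟩
    · exact h.notMem h3 h1
    · exact h4.ne' h2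
  · rintro ⟨i, j⟩ ⟨v, t⟩ hq
    by_cases hv : v ∈ A i
    · obtain ⟨k, hk, hkF⟩ := h.exists_subset_insert hv
      -- Lift `F k ⊆ insert v (F i)` by keeping the copies `j` and using copy `t` of `v`.
      let g : (x : V) → Fin (α x) :=
        Function.update (fun x => if h : x ∈ F i then j ⟨x, h⟩ else ⟨0, hα x⟩) v t
      refine ⟨⟨k, fun x => g x⟩, (ho _ _).2 (.inl hk), fun p hp => ?_⟩
      obtain ⟨hpk, hpg⟩ := mem_transversal.1 hp
      obtain ⟨x, y⟩ := p
      obtain rfl : g x = y := hpg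
      by_cases hxv : x = v
      · subst hxv
        simp [g]
      · have hxF : x ∈ F i := (Finset.mem_insert.1 (hkF hpk)).resolve_left hxv
        refine Finset.mem_insert_of_mem (mem_transversal.2 ⟨hxF, ?_⟩)
        simp [g, hxv, hxF]
    · obtain ⟨hvF, hlt⟩ := (mem_expansionColon.1 hq).resolve_left hv
      -- Lowering the copy of `v` to `t` decreases the weight.
      refine ⟨⟨i, Function.update j ⟨v, hvF⟩ t⟩, (ho _ _).2 (.inr ⟨rfl, .inl ?_⟩), fun p hp => ?_⟩
      · refine Finset.sum_lt_sum (fun x _ => ?_) ⟨⟨v, hvF⟩, Finset.mem_univ _, ?_⟩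
        · by_cases hx : x = ⟨v, hvF⟩
          · subst hx
            simpa using hlt.le
          · simp [hx]
        · simpa using hlt
      · obtain ⟨hpk, hpg⟩ := mem_transversal.1 hp
        obtain ⟨x, y⟩ := p
        by_cases hxv : x = v
        · subst hxv
          simp only [Function.update_self] at hpg
          subst hpg
          exact Finset.mem_insert_self _ _
        · refine Finset.mem_insert_of_mem (mem_transversal.2 ⟨hpk, ?_⟩)
          rw [← hpg]
          exact (Function.update_of_ne (fun h' => hxv (congrArg Subtype.val h')) _ _).symm

theorem sum_ite_mem_of_disjoint {B C : Finset V} (hd : Disjoint B C) (b c : ℕ) :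
    (∑ v, if v ∈ B then b else if v ∈ C then c else 0) = b * B.card + c * C.card := by
  have : ∀ v, (if v ∈ B then b else if v ∈ C then c else 0) =
      (if v ∈ B then b else 0) + if v ∈ C then c else 0 := by
    intro v
    by_cases h1 : v ∈ B
    · simp [h1, Finset.disjoint_left.1 hd h1]
    · simp [h1]
  simp [this, Finset.sum_add_distrib, Finset.sum_ite_mem, mul_comm]

theorem card_expansionColon_le [LT ι] (h : HasColonSets F A) {s : ℕ}
    (p : Σ i, (x : F i) → Fin ((fun _ : V => s) x)) :
    (expansionColon (fun _ => s) F A p).card ≤ s * (A p.1).card + (s - 1) * (F p.1).card := by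
  rw [card_expansionColon, ← sum_ite_mem_of_disjoint
    (Finset.disjoint_left.2 fun a ha ha' => h.notMem ha ha')]
  refine Finset.sum_le_sum fun v _ => ?_
  split_ifs with h1 h2
  · exact le_rfl
  · have := (p.2 ⟨v, h2⟩).2
    simp only at this
    omega
  · exact le_rfl

theorem card_expansionColon_last [LT ι] (h : HasColonSets F A) {s : ℕ} (hs : 1 ≤ s) (i : ι) :
    (expansionColon (fun _ => s) F A ⟨i, fun _ => ⟨s - 1, Nat.sub_lt hs one_pos⟩⟩).card =
      s * (A i).card + (s - 1) * (F i).card := by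
  rw [card_expansionColon, ← sum_ite_mem_of_disjoint
    (Finset.disjoint_left.2 fun a ha ha' => h.notMem ha ha')]
  refine Finset.sum_congr rfl fun v _ => ?_
  split_ifs <;> rfl

end HasColonSets

/-! ### Dimension, purity and the final count -/

namespace FaceComplex

variable {V : Type*} [Finite V] (Δ : FaceComplex V)

theorem exists_facet_of_mem_faces {G : Finset V} (hG : G ∈ Δ.faces) : ∃ F ∈ Δ.facets, G ⊆ F := by
  obtain ⟨F, hle, hF⟩ := (Set.toFinite Δ.faces).exists_le_maximal hG
  exact ⟨F, hF, hle⟩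

theorem card_le_dim_add_one {F : Finset V} (hF : F ∈ Δ.faces) : (F.card : ℤ) ≤ Δ.dim + 1 := by
  rw [dim, sub_add_cancel, Nat.cast_le]
  exact le_csSup (Set.toFinite _).bddAbove ⟨F, hF, rfl⟩

theorem IsPure.card_eq {Δ : FaceComplex V} (h : Δ.IsPure) {F : Finset V} (hF : F ∈ Δ.facets) :
    (F.card : ℤ) = Δ.dim + 1 := by
  refine le_antisymm (Δ.card_le_dim_add_one hF.1) ?_
  obtain ⟨G, hG, hGc⟩ := Nat.sSup_mem (s := Finset.card '' Δ.faces)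
    ⟨_, ∅, Δ.empty_mem, rfl⟩ (Set.toFinite _).bddAbove
  obtain ⟨G', hG', hle⟩ := Δ.exists_facet_of_mem_faces hG
  rw [dim, sub_add_cancel, Nat.cast_le, ← hGc, h F hF G' hG']
  exact Finset.card_le_card hle

end FaceComplex

theorem proposition2p8 {V K : Type*} [Finite V] [Field K] (Δ : FaceComplex V)
    (hΔ : MonomialIdeal.HasLinearQuotients (Δ.facetIdeal K)) (s : ℕ) (hs : 1 ≤ s) :
    ∃ p q : ℕ,
      MonomialIdeal.pd (Δ.facetIdeal K) = p ∧
      MonomialIdeal.pd ((Δ.expansion fun _ => s).facetIdeal K) = q ∧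
      (q : ℤ) ≤ s * p + (Δ.dim + 1) * (s - 1) ∧
      (Δ.IsPure → (q : ℤ) = s * p + (Δ.dim + 1) * (s - 1)) := by
  classical
  have := Fintype.ofFinite V
  obtain ⟨m, F, A, hFA, hinj, hrange⟩ := Δ.exists_hasColonSets hΔ
  have hfacet : ∀ i, F i ∈ Δ.facets := fun i => hrange ▸ Set.mem_range_self i
  have hanti : ∀ i j, F i ⊆ F j → i = j := fun i j hij =>
    hinj (Δ.eq_of_subset_of_mem_facets (hfacet i) (hfacet j) hij)
  have : Nonempty (Fin m) := by
    obtain ⟨G, hG, -⟩ := Δ.exists_facet_of_mem_faces Δ.empty_mem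
    obtain ⟨i, -⟩ : G ∈ Set.range F := hrange ▸ hG
    exact ⟨i⟩
  obtain ⟨i₀, hi₀⟩ := Finite.exists_max fun i => (A i).card
  have hp := MonomialIdeal.pd_span_prod_X (K := K) hFA hanti hi₀ ⟨i₀, rfl⟩
  rw [hrange] at hp
  obtain ⟨o, ho⟩ := hFA.exists_linearOrder_expansion (α := fun _ => s) fun _ => hs
  have : Nonempty (Σ i, (x : F i) → Fin ((fun _ : V => s) x)) := ⟨⟨i₀, fun _ => ⟨0, hs⟩⟩⟩
  obtain ⟨p₀, hp₀⟩ := Finite.exists_max fun p =>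
    (HasColonSets.expansionColon (fun _ => s) F A p).card
  have hq := @MonomialIdeal.pd_span_prod_X _ _ K _ _ _ _ o _ _ ho
    (by
      rintro ⟨i, j⟩ ⟨i', j'⟩ hle
      obtain rfl := hanti i i' (FaceComplex.subset_of_transversal_subset hle)
      exact congrArg (Sigma.mk i) (FaceComplex.eq_of_transversal_subset hle))
    _ hp₀ ⟨p₀, rfl⟩
  have hrange' : Set.range (fun p : Σ i, (x : F i) → Fin ((fun _ : V => s) x) =>
      FaceComplex.transversal (fun _ => s) (F p.1) p.2) = (Δ.expansion fun _ => s).facets := by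
    rw [Δ.facets_expansion fun _ => hs]
    ext G
    constructor
    · rintro ⟨p, rfl⟩
      exact ⟨F p.1, hfacet _, p.2, rfl⟩
    · rintro ⟨G', hG', j, rfl⟩
      obtain ⟨i, rfl⟩ : G' ∈ Set.range F := hrange ▸ hG'
      exact ⟨⟨i, j⟩, rfl⟩
  rw [hrange'] at hq
  have hs' : ((s - 1 : ℕ) : ℤ) = s - 1 := by push_cast [hs]; rfl
  have hs0 : (0 : ℤ) ≤ s - 1 := by omega
  have hle : (((HasColonSets.expansionColon (fun _ => s) F A p₀).card : ℕ) : ℤ) ≤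
      s * ((A i₀).card : ℕ) + (Δ.dim + 1) * (s - 1) := by
    have h1 : (((HasColonSets.expansionColon (fun _ => s) F A p₀).card : ℕ) : ℤ) ≤
        s * (A p₀.1).card + (s - 1) * (F p₀.1).card := by
      rw [← hs']
      exact_mod_cast hFA.card_expansionColon_le p₀
    have h2 : ((A p₀.1).card : ℤ) ≤ (A i₀).card := by exact_mod_cast hi₀ p₀.1
    have h3 := Δ.card_le_dim_add_one (hfacet p₀.1).1
    refine h1.trans (add_le_add (mul_le_mul_of_nonneg_left h2 (by positivity)) ?_)
    rw [mul_comm]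
    exact mul_le_mul_of_nonneg_right h3 hs0
  refine ⟨_, _, hp, hq, hle, fun hpure => le_antisymm hle ?_⟩
  rw [← hpure.card_eq (hfacet i₀), mul_comm (((F i₀).card : ℕ) : ℤ), ← hs']
  -- The last copies over a facet with `|A i₀|` maximal attain the bound.
  have h1 := hp₀ ⟨i₀, fun _ => ⟨s - 1, Nat.sub_lt hs one_pos⟩⟩
  simp only [hFA.card_expansionColon_last hs i₀] at h1
  exact_mod_cast h1
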